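/- Let $\mathcal C$ be the ring of germs at $+\infty$ of continuous functions $[a,+\infty)\to\mathbb R$ ($a\in\mathbb R$), let $\mathcal C^r$ be its subring of germs of $r$ times continuously differentiable functions $[a,+\infty)\to\mathbb R$ ($a\in\mathbb R$), and let $\mathcal C^{<\infty}=\bigcap_{r\in\mathbb N}\mathcal C^r$, a differential ring with the obvious derivation. For $g,h\in\mathcal C$ write $g<_{\mathrm e}h$ (or $h>_{\mathrm e}g$) if $g(t)<h(t)$ for all sufficiently large $t$; for $H\subseteq\mathcal C$, write $y>_{\mathrm e}H$ if $y>_{\mathrm e}h$ for all $h\in H$. A Hardy field is a subring of $\mathcal C^{<\infty}$ that is a field and is closed under the derivation. Real numbers are identified with germs of constant functions. A Hardy field $H$ is Liouville closed if it is real closed and for every $f\in H$ there are $g\in H$ with $g'=f$ and $z\in H\setminus\{0\}$ with $z'/z=f$. A germ $y\in\mathcal C$ is hardian if $y\in\mathcal C^{<\infty}$ and $y$ generates a Hardy field $\mathbb Q\langle y\rangle$ (that is, there is a smallest Hardy field containing $y$). Given a Hardy field $H$, it is $H$-hardian if it lies in some Hardy field extension of $H$. For $y\in\mathcal C^{<\infty}$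 put $y^{\langle 0\rangle}=y$ and, as long as $y^{\langle i\rangle}$ is defined and a unit of $\mathcal C^{<\infty}$, $y^{\langle i+1\rangle}=(y^{\langle i\rangle})'/y^{\langle i\rangle}$; otherwise $y^{\langle i+1\rangle}$ is undefined. The germ $y$ is overhardian if $y\in\mathcal C^{<\infty}$ and for all $i\in\mathbb N$, $y^{\langle i\rangle}$ is defined, $y^{\langle i\rangle}>_{\mathrm e}0$, and $y^{\langle i\rangle}>_{\mathrm e}y^{\langle i+1\rangle}$. Let $x$ be the germ of the identity function, $\exp_0(x)=x$ and $\exp_{n+1}(x)=\exp(\exp_n(x))$. 1. Let $H\supseteq\mathbb R$ be a Liouville closed Hardy field and let $y\in\mathcal C$ satisfy $y>_{\mathrm e}H$. Then the following are equivalent: (i) $y$ is overhardian; (ii) $y$ is $H$-hardian; (iii) $y$ is hardian. 2. If $y$ is overhardian, then so is $\log y$. Moreover, a germ $y\in\mathcal C$ is overhardian if and only if $y$ is hardian and $y>_{\mathrm e}\exp_n(x)$ for all $n\in\mathbb N$. -/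

import Mathlib

open Filter

namespace HardyGerm

/-- Germs at `+∞` of real-valued functions of a real variable. It is a commutative ring under the
pointwise operations; all the germs of interest lie in the subring `contGerms`. -/
abbrev RGerm : Type := Germ (atTop : Filter ℝ) ℝ

/-- `𝒞^r`: the germs of `r` times continuously differentiable functions `[a, +∞) → ℝ`, `a ∈ ℝ`. -/
def ckGerms (r : ℕ) : Set RGerm :=
  {y | ∃ (a : ℝ) (f : ℝ → ℝ), ContDiffOn ℝ r f (Set.Ici a) ∧ y = (f : RGerm)}

/-- `𝒞`: the germs of continuous functions `[a, +∞) → ℝ`, `a ∈ ℝ`. -/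
def contGerms : Set RGerm :=
  {y | ∃ (a : ℝ) (f : ℝ → ℝ), ContinuousOn f (Set.Ici a) ∧ y = (f : RGerm)}

/-- `𝒞^{<∞}`: the intersection of all the `𝒞^r`, `r ∈ ℕ`. -/
def smoothGerms : Set RGerm := {y | ∀ r : ℕ, y ∈ ckGerms r}

/-- Functions that agree near `+∞` have derivatives that agree near `+∞`. -/
theorem eventuallyEq_deriv {f g : ℝ → ℝ} (h : f =ᶠ[atTop] g) : deriv f =ᶠ[atTop] deriv g := by
  obtain ⟨a, ha⟩ := eventually_atTop.1 h
  filter_upwards [eventually_gt_atTop a] with t ht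
  apply EventuallyEq.deriv_eq
  filter_upwards [Ioi_mem_nhds ht] with s hs
  exact ha s (le_of_lt hs)

/-- The derivation on germs: the germ of `f` is sent to the germ of `f'`. It is used on `𝒞^{<∞}`. -/
noncomputable def der (y : RGerm) : RGerm :=
  Germ.map' deriv (fun _ _ h => eventuallyEq_deriv h) y

/-- `g <ₑ h`: `g(t) < h(t)` for all sufficiently large `t`. -/
def LtE (g h : RGerm) : Prop := Germ.LiftRel (· < ·) g h

/-- A Hardy field: a subring of `𝒞^{<∞}` that is a field and is closed under the derivation. -/
structure IsHardyField (H : Subring RGerm) : Prop where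
  subset_smooth : ∀ y ∈ H, y ∈ smoothGerms
  isField : IsField H
  der_mem : ∀ y ∈ H, der y ∈ H

/-- `ℝ ⊆ H`, where real numbers are identified with the germs of constant functions. -/
def ContainsReals (H : Subring RGerm) : Prop := ∀ c : ℝ, (Germ.const c : RGerm) ∈ H

/-- A Hardy field is Liouville closed if it is real closed, every element has an
antiderivative in it, and every element is the logarithmic derivative `z'/z` of some nonzero `z`
in it. -/
structure IsLiouvilleClosedHardyField (H : Subring RGerm) : Prop where
  isHardyField : IsHardyField H
  isRealClosed : @IsRealClosed H isHardyField.isField.toField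
  exists_integral : ∀ f ∈ H, ∃ g ∈ H, der g = f
  exists_exp_integral : ∀ f ∈ H, ∃ z ∈ H, z ≠ 0 ∧ der z = f * z

/-- `y` is `H`-hardian: `y` is contained in a Hardy field extension of `H`. -/
def IsHardianOver (H : Subring RGerm) (y : RGerm) : Prop :=
  ∃ F : Subring RGerm, IsHardyField F ∧ H ≤ F ∧ y ∈ F

/-- `y` is hardian: `y ∈ 𝒞^{<∞}` and `y` generates a Hardy field `ℚ⟨y⟩`, that is, there is
a smallest Hardy field that contains `y`. -/
def IsHardian (y : RGerm) : Prop :=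
  y ∈ smoothGerms ∧ ∃ F : Subring RGerm, IsLeast {F | IsHardyField F ∧ y ∈ F} F

/-- `y` is a unit of the ring `𝒞^{<∞}`. -/
def IsSmoothUnit (y : RGerm) : Prop := y ∈ smoothGerms ∧ ∃ z ∈ smoothGerms, y * z = 1

/-- The logarithmic derivative `y† = y'/y`, for `y` a unit of `𝒞^{<∞}`. -/
noncomputable def logDer (y : RGerm) : RGerm := der y / y

/-- `y^⟨i⟩`: `y^⟨0⟩ = y` and `y^⟨i+1⟩ = (y^⟨i⟩)†`; meaningful if `LogDerDefined y i`. -/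
noncomputable def iterLogDer (y : RGerm) : ℕ → RGerm
  | 0 => y
  | i + 1 => logDer (iterLogDer y i)

/-- `y^⟨i⟩` is defined (for `y ∈ 𝒞^{<∞}`): all the previous `y^⟨j⟩` are units of `𝒞^{<∞}`. -/
def LogDerDefined (y : RGerm) : ℕ → Prop
  | 0 => y ∈ smoothGerms
  | i + 1 => LogDerDefined y i ∧ IsSmoothUnit (iterLogDer y i)

/-- `y` is overhardian: `y ∈ 𝒞^{<∞}` and for all `i`, `y^⟨i⟩` is defined, `y^⟨i⟩ >ₑ 0` and
`y^⟨i⟩ >ₑ y^⟨i+1⟩`. -/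
def IsOverhardian (y : RGerm) : Prop :=
  y ∈ smoothGerms ∧ ∀ i : ℕ, LogDerDefined y i ∧ LtE 0 (iterLogDer y i) ∧
    LtE (iterLogDer y (i + 1)) (iterLogDer y i)

/-- The germ `log y` of `t ↦ log (y t)`, for `y >ₑ 0`. -/
noncomputable def logGerm (y : RGerm) : RGerm := Germ.map Real.log y

/-- The germ `exp_n(x)`: `exp_0(x) = x` is the germ of the identity, and
`exp_{n+1}(x) = exp(exp_n(x))`. -/
noncomputable def expIter (n : ℕ) : RGerm := ((Real.exp^[n] : ℝ → ℝ) : RGerm)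

end HardyGerm

/-! ### Smooth germs and their derivation. -/

namespace HardyGerm

/-! An overhardian germ is the head of a chain `z 0 > z 1 > ... > 0` with `(z i)' = z i * z (i +
1)`. Integrating inequalities along the chain shows that each `z i` tends to infinity and exceeds
every power of `z (i + 1)` (`LogDerChain.pow_lt`), so monomials in the `z i` grow in lexicographic
order. If all `z i` lie above a Hardy field `H`, the lexicographically largest monomial dominates
any nonzero polynomial over `H` (`LogDerChain.isUnit_aeval`); hence `H[z 0, z 1, ...]` is a
differential ring whose nonzero elements are invertible germs, and its fractions form a Hardy field.
Over the constants this makes every overhardian germ hardian. For Liouville closed `H`, `log (z 0) ≤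
t * z 1 + C` and closure of `H` under `exp` carry `z 0 > H` down the chain.

Conversely, if an element of a Hardy field exceeds all `exp_n(x)`, its logarithmic derivative does
too and is smaller than the element (`IsHardyField.logDer_of_expIter_lt`); iterating gives an
overhardian germ. For `log y`, adjoin it to a Hardy field containing `y`: its derivative is already
there, and Rolle's theorem controls polynomials in it. -/

/-- `f` is, for each `r`, of class `C^r` near `+∞`. -/
def SmoothAtTop (f : ℝ → ℝ) : Prop := ∀ r : ℕ, ∀ᶠ t in atTop, ContDiffAt ℝ r f t

theorem coe_mem_smoothGerms {f : ℝ → ℝ} : (f : RGerm) ∈ smoothGerms ↔ SmoothAtTop f := by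
  constructor
  · intro h r
    obtain ⟨a, g, hg, hfg⟩ := h r
    obtain ⟨b, hb⟩ := eventually_atTop.1 (Germ.coe_eq.1 hfg)
    filter_upwards [eventually_gt_atTop a, eventually_gt_atTop b] with t hta htb
    refine (hg.contDiffAt (Ici_mem_nhds hta)).congr_of_eventuallyEq ?_
    filter_upwards [Ioi_mem_nhds htb] with s hs using hb s (le_of_lt hs)
  · intro h r
    obtain ⟨a, ha⟩ := eventually_atTop.1 (h r)
    exact ⟨a, f, fun t ht => (ha t ht).contDiffWithinAt, rfl⟩

namespace SmoothAtTop

variable {f g : ℝ → ℝ}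

theorem differentiableAt (hf : SmoothAtTop f) : ∀ᶠ t in atTop, DifferentiableAt ℝ f t := by
  filter_upwards [hf 1] with t ht using ht.differentiableAt (by norm_num)

theorem continuousAt (hf : SmoothAtTop f) : ∀ᶠ t in atTop, ContinuousAt f t :=
  hf.differentiableAt.mono fun _ h => h.continuousAt

theorem add (hf : SmoothAtTop f) (hg : SmoothAtTop g) : SmoothAtTop (f + g) := fun r => by
  filter_upwards [hf r, hg r] with t h₁ h₂ using h₁.add h₂

theorem mul (hf : SmoothAtTop f) (hg : SmoothAtTop g) : SmoothAtTop (f * g) := fun r => by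
  filter_upwards [hf r, hg r] with t h₁ h₂ using h₁.mul h₂

theorem neg (hf : SmoothAtTop f) : SmoothAtTop (-f) := fun r => by
  filter_upwards [hf r] with t h₁ using h₁.neg

theorem inv (hf : SmoothAtTop f) (h0 : ∀ᶠ t in atTop, f t ≠ 0) : SmoothAtTop f⁻¹ := fun r => by
  filter_upwards [hf r, h0] with t h₁ h₂ using h₁.inv h₂

theorem log (hf : SmoothAtTop f) (h0 : ∀ᶠ t in atTop, f t ≠ 0) :
    SmoothAtTop (fun t => Real.log (f t)) := fun r => by
  filter_upwards [hf r, h0] with t h₁ h₂ using h₁.log h₂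

theorem const (c : ℝ) : SmoothAtTop (fun _ => c) := fun _ => .of_forall fun _ => contDiffAt_const

theorem deriv (hf : SmoothAtTop f) : SmoothAtTop (deriv f) := fun r => by
  filter_upwards [hf (r + 1)] with t ht
  exact (ht.fderiv_right (m := r) (by norm_cast)).clm_apply contDiffAt_const

end SmoothAtTop

theorem der_coe (f : ℝ → ℝ) : der (f : RGerm) = (deriv f : ℝ → ℝ) := rfl

theorem ltE_coe {f g : ℝ → ℝ} : LtE (f : RGerm) g ↔ ∀ᶠ t in atTop, f t < g t := Iff.rfl

/-- `𝒞^{<∞}` as a subring. -/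
def smoothSubring : Subring RGerm where
  carrier := smoothGerms
  mul_mem' {a b} := by
    induction a using Germ.inductionOn with | h f => ?_
    induction b using Germ.inductionOn with | h g => ?_
    intro ha hb
    exact coe_mem_smoothGerms.2 ((coe_mem_smoothGerms.1 ha).mul (coe_mem_smoothGerms.1 hb))
  one_mem' := coe_mem_smoothGerms.2 (SmoothAtTop.const 1)
  add_mem' {a b} := by
    induction a using Germ.inductionOn with | h f => ?_
    induction b using Germ.inductionOn with | h g => ?_
    intro ha hb
    exact coe_mem_smoothGerms.2 ((coe_mem_smoothGerms.1 ha).add (coe_mem_smoothGerms.1 hb))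
  zero_mem' := coe_mem_smoothGerms.2 (SmoothAtTop.const 0)
  neg_mem' {a} := by
    induction a using Germ.inductionOn with | h f => ?_
    intro ha
    exact coe_mem_smoothGerms.2 (coe_mem_smoothGerms.1 ha).neg

theorem der_add {a b : RGerm} (ha : a ∈ smoothGerms) (hb : b ∈ smoothGerms) :
    der (a + b) = der a + der b := by
  induction a using Germ.inductionOn with | h f => ?_
  induction b using Germ.inductionOn with | h g => ?_
  refine Germ.coe_eq.2 ?_
  filter_upwards [(coe_mem_smoothGerms.1 ha).differentiableAt,
    (coe_mem_smoothGerms.1 hb).differentiableAt] with t h₁ h₂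
  exact deriv_add h₁ h₂

theorem der_mul {a b : RGerm} (ha : a ∈ smoothGerms) (hb : b ∈ smoothGerms) :
    der (a * b) = der a * b + a * der b := by
  induction a using Germ.inductionOn with | h f => ?_
  induction b using Germ.inductionOn with | h g => ?_
  refine Germ.coe_eq.2 ?_
  filter_upwards [(coe_mem_smoothGerms.1 ha).differentiableAt,
    (coe_mem_smoothGerms.1 hb).differentiableAt] with t h₁ h₂
  exact deriv_mul h₁ h₂

theorem der_neg (a : RGerm) : der (-a) = -der a := by
  induction a using Germ.inductionOn with | h f => ?_
  exact congrArg _ (deriv.neg')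

theorem der_const (c : ℝ) : der (Germ.const c) = 0 :=
  congrArg (fun f : ℝ → ℝ => (f : RGerm)) (deriv_const' c)

theorem der_zero : der 0 = 0 := der_const 0

theorem der_one : der 1 = 0 := der_const 1

theorem isUnit_coe {f : ℝ → ℝ} : IsUnit (f : RGerm) ↔ ∀ᶠ t in atTop, f t ≠ 0 := by
  constructor
  · rintro h
    obtain ⟨b, hb⟩ := isUnit_iff_exists_inv.1 h
    induction b using Germ.inductionOn with | h g => ?_
    have : ∀ᶠ t in atTop, f t * g t = 1 := Germ.coe_eq.1 hb
    filter_upwards [this] with t ht h0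
    simp [h0] at ht
  · intro h
    refine isUnit_iff_exists_inv.2 ⟨((f⁻¹ : ℝ → ℝ) : RGerm), Germ.coe_eq.2 ?_⟩
    filter_upwards [h] with t ht
    exact mul_inv_cancel₀ ht

theorem mem_smoothGerms_of_mul_eq_one {a b : RGerm} (ha : a ∈ smoothGerms) (h : a * b = 1) :
    b ∈ smoothGerms := by
  induction a using Germ.inductionOn with | h f => ?_
  have h0 := isUnit_coe.1 (IsUnit.of_mul_eq_one _ h)
  have : b = ((f⁻¹ : ℝ → ℝ) : RGerm) := by
    have h2 : (f : RGerm) * ((f⁻¹ : ℝ → ℝ) : RGerm) = 1 := by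
      refine Germ.coe_eq.2 ?_
      filter_upwards [h0] with t ht
      exact mul_inv_cancel₀ ht
    calc b = b * ((f : RGerm) * ((f⁻¹ : ℝ → ℝ) : RGerm)) := by rw [h2, mul_one]
      _ = ((f : RGerm) * b) * ((f⁻¹ : ℝ → ℝ) : RGerm) := by ring
      _ = _ := by rw [h, one_mul]
  rw [this]
  exact coe_mem_smoothGerms.2 ((coe_mem_smoothGerms.1 ha).inv h0)

/-! ### Building Hardy fields from differential rings of germs. -/

theorem IsHardyField.isUnit {H : Subring RGerm} (hH : IsHardyField H) {a : RGerm} (ha : a ∈ H)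
    (h0 : a ≠ 0) : ∃ b ∈ H, a * b = 1 := by
  obtain ⟨b, hb⟩ := hH.isField.mul_inv_cancel (a := ⟨a, ha⟩) (fun h => h0 (congrArg Subtype.val h))
  exact ⟨b, b.2, congrArg Subtype.val hb⟩

/-- The fractions `a / b` with `a`, `b` in `R` and `b` a unit in the ring of germs. -/
def fractions (R : Subring RGerm) : Subring RGerm where
  carrier := {f | ∃ a ∈ R, ∃ b ∈ R, IsUnit b ∧ f * b = a}
  mul_mem' := by
    rintro f g ⟨a, ha, b, hb, hu, h⟩ ⟨c, hc, d, hd, hv, h'⟩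
    exact ⟨a * c, R.mul_mem ha hc, b * d, R.mul_mem hb hd, hu.mul hv, by rw [← h, ← h']; ring⟩
  one_mem' := ⟨1, R.one_mem, 1, R.one_mem, isUnit_one, one_mul 1⟩
  add_mem' := by
    rintro f g ⟨a, ha, b, hb, hu, h⟩ ⟨c, hc, d, hd, hv, h'⟩
    exact ⟨a * d + c * b, R.add_mem (R.mul_mem ha hd) (R.mul_mem hc hb), b * d, R.mul_mem hb hd,
      hu.mul hv, by rw [← h, ← h']; ring⟩
  zero_mem' := ⟨0, R.zero_mem, 1, R.one_mem, isUnit_one, zero_mul 1⟩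
  neg_mem' := by
    rintro f ⟨a, ha, b, hb, hu, h⟩
    exact ⟨-a, R.neg_mem ha, b, hb, hu, by rw [← h]; ring⟩

theorem le_fractions (R : Subring RGerm) : R ≤ fractions R := fun a ha =>
  ⟨a, ha, 1, R.one_mem, isUnit_one, mul_one a⟩

theorem isHardyField_fractions {R : Subring RGerm} (hs : ∀ a ∈ R, a ∈ smoothGerms)
    (hd : ∀ a ∈ R, der a ∈ R) (hu : ∀ a ∈ R, a ≠ 0 → IsUnit a) : IsHardyField (fractions R) := by
  have smooth : ∀ f ∈ fractions R, f ∈ smoothGerms := by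
    rintro f ⟨a, ha, b, hb, hub, h⟩
    obtain ⟨c, hc⟩ := isUnit_iff_exists_inv.1 hub
    have : f = a * c := by rw [← h, mul_assoc, hc, mul_one]
    rw [this]
    exact smoothSubring.mul_mem (hs a ha) (mem_smoothGerms_of_mul_eq_one (hs b hb) hc)
  refine ⟨smooth, ⟨⟨0, 1, zero_ne_one⟩, mul_comm, ?_⟩, ?_⟩
  · rintro ⟨f, a, ha, b, hb, hub, h⟩ h0
    have ha0 : a ≠ 0 := by
      rintro rfl
      exact h0 (Subtype.ext ((hub.mul_left_eq_zero).1 h))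
    obtain ⟨c, hc⟩ := isUnit_iff_exists_inv.1 (hu a ha ha0)
    refine ⟨⟨b * c, b, hb, a, ha, hu a ha ha0, ?_⟩, Subtype.ext ?_⟩
    · rw [mul_assoc, mul_comm c, hc, mul_one]
    · change f * (b * c) = 1
      rw [← mul_assoc, h, hc]
  · rintro f hf
    obtain ⟨a, ha, b, hb, hub, h⟩ := id hf
    -- The quotient rule, obtained by differentiating `f * b = a`.
    refine ⟨der a * b - a * der b, R.sub_mem (R.mul_mem (hd a ha) hb) (R.mul_mem ha (hd b hb)),
      b * b, R.mul_mem hb hb, hub.mul hub, ?_⟩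
    rw [← h, der_mul (smooth f hf) (hs b hb)]
    ring

theorem exists_isHardyField_of_generators {S : Set RGerm} (hs : S ⊆ smoothGerms)
    (hd : ∀ a ∈ S, der a ∈ Subring.closure S)
    (hu : ∀ a ∈ Subring.closure S, a ≠ 0 → IsUnit a) :
    ∃ F : Subring RGerm, IsHardyField F ∧ S ⊆ F := by
  have hs' : Subring.closure S ≤ smoothSubring := Subring.closure_le.2 hs
  refine ⟨fractions (Subring.closure S), isHardyField_fractions (fun a ha => hs' ha) ?_ hu,
    fun a ha => le_fractions _ (Subring.subset_closure ha)⟩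
  intro a ha
  induction ha using Subring.closure_induction with
  | mem a h => exact hd a h
  | zero => rw [der_zero]; exact Subring.zero_mem _
  | one => rw [der_one]; exact Subring.zero_mem _
  | add a b ha hb h₁ h₂ => rw [der_add (hs' ha) (hs' hb)]; exact Subring.add_mem _ h₁ h₂
  | neg a ha h => rw [der_neg]; exact Subring.neg_mem _ h
  | mul a b ha hb h₁ h₂ =>
    rw [der_mul (hs' ha) (hs' hb)]
    exact Subring.add_mem _ (Subring.mul_mem _ h₁ hb) (Subring.mul_mem _ ha h₂)

/-- The intersection of all Hardy fields containing `y` is again a field: inverses are unique in the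
ring of germs, so each of those fields contains the same one. -/
theorem IsHardianOver.isHardian {H : Subring RGerm} {y : RGerm} (h : IsHardianOver H y) :
    IsHardian y := by
  obtain ⟨F, hF, -, hy⟩ := h
  refine ⟨hF.subset_smooth y hy, sInf {F | IsHardyField F ∧ y ∈ F}, ⟨⟨?_, ?_, ?_⟩, ?_⟩, ?_⟩
  · exact fun a ha => hF.subset_smooth a (Subring.mem_sInf.1 ha F ⟨hF, hy⟩)
  · refine ⟨⟨0, 1, zero_ne_one⟩, mul_comm, ?_⟩
    rintro ⟨a, ha⟩ h0
    have ha0 : a ≠ 0 := fun h => h0 (Subtype.ext h)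
    obtain ⟨b, -, hb⟩ := hF.isUnit (Subring.mem_sInf.1 ha F ⟨hF, hy⟩) ha0
    refine ⟨⟨b, Subring.mem_sInf.2 fun K hK => ?_⟩, Subtype.ext hb⟩
    obtain ⟨c, hc, hac⟩ := hK.1.isUnit (Subring.mem_sInf.1 ha K hK) ha0
    rwa [← left_inv_eq_right_inv (by rwa [mul_comm] at hac) hb]
  · exact fun a ha => Subring.mem_sInf.2 fun K hK => hK.1.der_mem a (Subring.mem_sInf.1 ha K hK)
  · exact Subring.mem_sInf.2 fun K hK => hK.2
  · exact fun K hK => sInf_le hK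

/-! ### Integrating differential inequalities near infinity. -/

theorem exists_monotoneOn_of_deriv_nonneg {f : ℝ → ℝ} (hf : ∀ᶠ t in atTop, DifferentiableAt ℝ f t)
    (h : ∀ᶠ t in atTop, 0 ≤ deriv f t) : ∃ a, MonotoneOn f (Set.Ici a) := by
  obtain ⟨a, ha⟩ := eventually_atTop.1 (hf.and h)
  refine ⟨a, monotoneOn_of_deriv_nonneg (convex_Ici a)
    (fun t ht => (ha t ht).1.continuousAt.continuousWithinAt) ?_ ?_⟩ <;>
  · intro t ht
    rw [interior_Ici] at ht
    first
    | exact (ha t (le_of_lt ht)).1.differentiableWithinAt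
    | exact (ha t (le_of_lt ht)).2

theorem exists_le_add_of_deriv_le {f g : ℝ → ℝ} (hf : ∀ᶠ t in atTop, DifferentiableAt ℝ f t)
    (hg : ∀ᶠ t in atTop, DifferentiableAt ℝ g t) (h : ∀ᶠ t in atTop, deriv g t ≤ deriv f t) :
    ∃ C, ∀ᶠ t in atTop, g t ≤ f t + C := by
  obtain ⟨a, ha⟩ := exists_monotoneOn_of_deriv_nonneg (f := f - g)
    (by filter_upwards [hf, hg] with t h₁ h₂ using h₁.sub h₂)
    (by
      filter_upwards [hf, hg, h] with t h₁ h₂ h₃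
      rw [deriv_sub h₁ h₂]
      linarith)
  refine ⟨g a - f a, ?_⟩
  filter_upwards [eventually_ge_atTop a] with t ht
  have := ha (Set.mem_Ici.2 le_rfl) ht ht
  simp only [Pi.sub_apply] at this
  linarith

theorem tendsto_atTop_of_le_deriv {f : ℝ → ℝ} (hf : ∀ᶠ t in atTop, DifferentiableAt ℝ f t)
    {c : ℝ} (hc : 0 < c) (h : ∀ᶠ t in atTop, c ≤ deriv f t) : Tendsto f atTop atTop := by
  obtain ⟨C, hC⟩ := exists_le_add_of_deriv_le (g := fun t => c * t) hf
    (.of_forall fun t => (differentiableAt_id.const_mul c))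
    (by
      filter_upwards [h] with t ht
      have : deriv (fun t : ℝ => c * t) t = c := by simp
      rwa [this])
  have : Tendsto (fun t => f t + C) atTop atTop :=
    tendsto_atTop_mono' _ hC (tendsto_id.const_mul_atTop hc)
  simpa using tendsto_atTop_add_const_right _ (-C) this

/-! ### Growth along a chain of logarithmic derivatives. -/

/-- A sequence of germs of positive functions, each the logarithmic derivative of the previous one
and less than it. -/
structure LogDerChain (z : ℕ → ℝ → ℝ) : Prop where
  smooth : ∀ i, SmoothAtTop (z i)
  pos : ∀ i, ∀ᶠ t in atTop, 0 < z i t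
  lt : ∀ i, ∀ᶠ t in atTop, z (i + 1) t < z i t
  deriv_eq : ∀ i, ∀ᶠ t in atTop, deriv (z i) t = z i t * z (i + 1) t

namespace LogDerChain

variable {z : ℕ → ℝ → ℝ}

theorem tail (hz : LogDerChain z) : LogDerChain (fun i => z (i + 1)) :=
  ⟨fun i => hz.smooth (i + 1), fun i => hz.pos (i + 1), fun i => hz.lt (i + 1),
    fun i => hz.deriv_eq (i + 1)⟩

theorem differentiableAt (hz : LogDerChain z) (i : ℕ) :
    ∀ᶠ t in atTop, DifferentiableAt ℝ (z i) t :=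
  (hz.smooth i).differentiableAt

theorem hasDerivAt_log (hz : LogDerChain z) (i : ℕ) :
    ∀ᶠ t in atTop, HasDerivAt (fun s => Real.log (z i s)) (z (i + 1) t) t := by
  filter_upwards [hz.differentiableAt i, hz.pos i, hz.deriv_eq i] with t h₁ h₂ h₃
  have := h₁.hasDerivAt.log h₂.ne'
  rwa [h₃, mul_div_cancel_left₀ _ h₂.ne'] at this

theorem exists_pos_le (hz : LogDerChain z) (i : ℕ) : ∃ c > 0, ∀ᶠ t in atTop, c ≤ z i t := by
  obtain ⟨a, ha⟩ := exists_monotoneOn_of_deriv_nonneg (hz.differentiableAt i) (by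
    filter_upwards [hz.deriv_eq i, hz.pos i, hz.pos (i + 1)] with t h₁ h₂ h₃
    rw [h₁]
    positivity)
  obtain ⟨b, hab, hb⟩ := ((eventually_ge_atTop a).and (hz.pos i)).exists
  refine ⟨z i b, hb, ?_⟩
  filter_upwards [eventually_ge_atTop b] with t ht using ha hab (hab.trans ht) ht

/-- The difference has derivative `z (i + 1) - z (i + 2) > 0`, so it eventually stays above one of
its positive values. This first crude gap is amplified in the next two lemmas. -/
theorem exists_pos_le_log_sub_log (hz : LogDerChain z) (i : ℕ) :
    ∃ δ > 0, ∀ᶠ t in atTop, δ ≤ Real.log (z i t) - Real.log (z (i + 1) t) := by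
  have hd : ∀ᶠ t in atTop, HasDerivAt (fun s => Real.log (z i s) - Real.log (z (i + 1) s))
      (z (i + 1) t - z (i + 2) t) t := by
    filter_upwards [hz.hasDerivAt_log i, hz.hasDerivAt_log (i + 1)] with t h₁ h₂ using h₁.sub h₂
  obtain ⟨a, ha⟩ := exists_monotoneOn_of_deriv_nonneg (hd.mono fun _ h => h.differentiableAt) (by
    filter_upwards [hd, hz.lt (i + 1)] with t h₁ h₂
    rw [h₁.deriv]
    exact (sub_pos.2 h₂).le)
  obtain ⟨b, hab, hb, hb'⟩ := ((eventually_ge_atTop a).and ((hz.lt i).and (hz.pos (i + 1)))).exists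
  refine ⟨_, sub_pos.2 (Real.log_lt_log hb' hb), ?_⟩
  filter_upwards [eventually_ge_atTop b] with t ht using ha hab (hab.trans ht) ht

/-- The gap `δ` one level down gives `z (i + 1) - z (i + 2) ≥ (exp δ - 1) * z (i + 2) ≥ δ * c`, a
positive lower bound for the derivative. -/
theorem tendsto_log_sub_log (hz : LogDerChain z) (i : ℕ) :
    Tendsto (fun t => Real.log (z i t) - Real.log (z (i + 1) t)) atTop atTop := by
  obtain ⟨δ, hδ, h⟩ := hz.exists_pos_le_log_sub_log (i + 1)
  obtain ⟨c, hc, h'⟩ := hz.exists_pos_le (i + 2)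
  have hd : ∀ᶠ t in atTop, HasDerivAt (fun s => Real.log (z i s) - Real.log (z (i + 1) s))
      (z (i + 1) t - z (i + 2) t) t := by
    filter_upwards [hz.hasDerivAt_log i, hz.hasDerivAt_log (i + 1)] with t h₁ h₂ using h₁.sub h₂
  refine tendsto_atTop_of_le_deriv (hd.mono fun _ h => h.differentiableAt) (mul_pos hδ hc) ?_
  filter_upwards [hd, h, h', hz.pos (i + 1), hz.pos (i + 2)] with t h₁ h₂ h₃ h₄ h₅
  rw [h₁.deriv]
  have h₆ : z (i + 2) t * Real.exp δ ≤ z (i + 1) t := by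
    rw [← Real.log_le_log_iff (by positivity) h₄, Real.log_mul h₅.ne' (Real.exp_ne_zero _),
      Real.log_exp]
    linarith
  nlinarith [Real.add_one_le_exp δ, mul_le_mul_of_nonneg_left h₃ hδ.le,
    mul_le_mul_of_nonneg_left (Real.add_one_le_exp δ) h₅.le]

/-- After taking logarithms the derivative of the difference is `z (i + 1) - n * z (i + 2)`, which
is bounded below because `z (i + 1) / z (i + 2)` tends to infinity. -/
theorem pow_lt (hz : LogDerChain z) (i n : ℕ) : ∀ᶠ t in atTop, z (i + 1) t ^ n < z i t := by
  obtain ⟨c, hc, h'⟩ := hz.exists_pos_le (i + 2)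
  have hd : ∀ᶠ t in atTop, HasDerivAt (fun s => Real.log (z i s) - n * Real.log (z (i + 1) s))
      (z (i + 1) t - n * z (i + 2) t) t := by
    filter_upwards [hz.hasDerivAt_log i, hz.hasDerivAt_log (i + 1)] with t h₁ h₂
      using h₁.sub (h₂.const_mul _)
  have ht := tendsto_atTop_of_le_deriv (hd.mono fun _ h => h.differentiableAt) hc (by
    filter_upwards [hd, h', (hz.tendsto_log_sub_log (i + 1)).eventually_ge_atTop (n + 1 : ℝ),
      hz.pos (i + 1), hz.pos (i + 2)] with t h₁ h₂ h₃ h₄ h₅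
    rw [h₁.deriv]
    have h₆ : z (i + 2) t * Real.exp (n + 1) ≤ z (i + 1) t := by
      rw [← Real.log_le_log_iff (by positivity) h₄, Real.log_mul h₅.ne' (Real.exp_ne_zero _),
        Real.log_exp]
      linarith
    nlinarith [mul_le_mul_of_nonneg_left (Real.add_one_le_exp (n + 1 : ℝ)) h₅.le])
  filter_upwards [ht.eventually_gt_atTop 0, hz.pos i, hz.pos (i + 1)] with t h₁ h₂ h₃
  rw [← Real.log_lt_log_iff (by positivity) h₂, Real.log_pow]
  linarith

theorem tendsto_atTop (hz : LogDerChain z) (i : ℕ) : Tendsto (z i) atTop atTop := by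
  obtain ⟨c, hc, h⟩ := hz.exists_pos_le (i + 1)
  have := tendsto_atTop_of_le_deriv
    ((hz.hasDerivAt_log i).mono fun _ h => h.differentiableAt) hc (by
      filter_upwards [hz.hasDerivAt_log i, h] with t h₁ h₂
      rwa [h₁.deriv])
  refine (Real.tendsto_exp_atTop.comp this).congr' ?_
  filter_upwards [hz.pos i] with t ht using Real.exp_log ht

theorem lt_log (hz : LogDerChain z) (i : ℕ) :
    ∀ᶠ t in atTop, z (i + 2) t < Real.log (z i t) := by
  have hd : ∀ᶠ t in atTop, HasDerivAt (fun s => Real.log (z i s) - z (i + 2) s)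
      (z (i + 1) t - z (i + 2) t * z (i + 3) t) t := by
    filter_upwards [hz.hasDerivAt_log i, hz.differentiableAt (i + 2), hz.deriv_eq (i + 2)]
      with t h₁ h₂ h₃
    have := h₁.sub h₂.hasDerivAt
    rwa [h₃] at this
  -- With `w = z (i + 2) ≥ 2`, the derivative is at least `w ^ 3 - w ^ 2 ≥ 1`, since `z (i + 1) > w
  -- ^ 3` and `z (i + 3) < w`.
  have ht := tendsto_atTop_of_le_deriv (hd.mono fun _ h => h.differentiableAt) one_pos (by
    filter_upwards [hd, (hz.tendsto_atTop (i + 2)).eventually_ge_atTop 1,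
      (hz.tendsto_atTop (i + 3)).eventually_ge_atTop 1, hz.pow_lt (i + 1) 3, hz.lt (i + 2),
      (hz.tendsto_atTop (i + 2)).eventually_ge_atTop 2] with t h₁ h₂ h₃ h₄ h₅ h₆
    rw [h₁.deriv]
    have : z (i + 1 + 1) t = z (i + 2) t := rfl
    have : z (i + 2 + 1) t = z (i + 3) t := rfl
    nlinarith [mul_pos (show 0 < z (i + 2) t by linarith) (show 0 < z (i + 2) t by linarith)])
  filter_upwards [ht.eventually_gt_atTop 0] with t ht
  linarith

/-- By `lt_log`, one exponential is gained for every two steps of the chain, so the induction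
hypothesis is applied to the chain shifted by two. -/
theorem exp_iterate_lt (n : ℕ) : ∀ {z : ℕ → ℝ → ℝ}, LogDerChain z →
    ∀ᶠ t in atTop, Real.exp^[n] t < z 0 t := by
  induction n with
  | zero =>
    intro z hz
    have ht := tendsto_atTop_of_le_deriv (f := fun t => Real.log (z 0 t) - t) (c := 1) (by
      filter_upwards [hz.hasDerivAt_log 0] with t h₁
        using (h₁.sub (hasDerivAt_id t)).differentiableAt) one_pos (by
      filter_upwards [hz.hasDerivAt_log 0, (hz.tendsto_atTop 1).eventually_ge_atTop 2] with t h₁ h₂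
      have : HasDerivAt (fun t => Real.log (z 0 t) - t) (z 1 t - 1) t := h₁.sub (hasDerivAt_id' t)
      rw [this.deriv]
      linarith)
    filter_upwards [ht.eventually_gt_atTop 0, hz.pos 0] with t h₁ h₂
    have := Real.log_le_sub_one_of_pos h₂
    simp only [Function.iterate_zero, id]
    linarith
  | succ n ih =>
    intro z hz
    filter_upwards [ih hz.tail.tail, hz.lt_log 0, hz.pos 0] with t h₁ h₂ h₃
    rw [Function.iterate_succ_apply', ← Real.lt_log_iff_exp_lt h₃]
    exact h₁.trans h₂

theorem coe_eq_iterLogDer (hz : LogDerChain z) (i : ℕ) :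
    iterLogDer (z 0 : RGerm) i = (z i : RGerm) := by
  induction i with
  | zero => rfl
  | succ i ih =>
    rw [iterLogDer, ih]
    refine Germ.coe_eq.2 ?_
    filter_upwards [hz.pos i, hz.deriv_eq i] with t h₁ h₂
    rw [h₂, mul_div_cancel_left₀ _ h₁.ne']

theorem isOverhardian (hz : LogDerChain z) : IsOverhardian (z 0 : RGerm) := by
  refine ⟨coe_mem_smoothGerms.2 (hz.smooth 0), fun i => ⟨?_, ?_, ?_⟩⟩
  · induction i with
    | zero => exact coe_mem_smoothGerms.2 (hz.smooth 0)
    | succ i ih =>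
      refine ⟨ih, ?_⟩
      rw [hz.coe_eq_iterLogDer]
      have hs := coe_mem_smoothGerms.2 (hz.smooth i)
      have hu : IsUnit (z i : RGerm) := isUnit_coe.2 ((hz.pos i).mono fun _ h => h.ne')
      obtain ⟨b, hb⟩ := isUnit_iff_exists_inv.1 hu
      exact ⟨hs, b, mem_smoothGerms_of_mul_eq_one hs hb, hb⟩
  · rw [hz.coe_eq_iterLogDer]
    exact hz.pos i
  · rw [hz.coe_eq_iterLogDer, hz.coe_eq_iterLogDer]
    exact hz.lt i

end LogDerChain

theorem IsOverhardian.exists_logDerChain {f : ℝ → ℝ} (h : IsOverhardian (f : RGerm)) :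
    ∃ z, LogDerChain z ∧ z 0 = f := by
  let z : ℕ → (ℝ → ℝ) := fun i => Nat.rec (motive := fun _ => ℝ → ℝ) f (fun _ g => deriv g / g) i
  have hz : ∀ i, iterLogDer (f : RGerm) i = ((z i : ℝ → ℝ) : RGerm) := by
    intro i
    induction i with
    | zero => rfl
    | succ i ih => rw [iterLogDer, ih]; rfl
  have hp : ∀ i, ∀ᶠ t in atTop, 0 < z i t := by
    intro i
    have := (h.2 i).2.1
    rw [hz] at this
    exact this
  refine ⟨z, ⟨?_, hp, ?_, ?_⟩, rfl⟩
  · intro i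
    induction i with
    | zero => exact coe_mem_smoothGerms.1 h.1
    | succ i ih =>
      have := ih.deriv.mul (ih.inv ((hp i).mono fun _ h => h.ne'))
      rwa [← div_eq_mul_inv] at this
  · intro i
    have := (h.2 i).2.2
    rw [hz, hz] at this
    exact this
  · intro i
    filter_upwards [hp i] with t ht
    change _ = z i t * (deriv (z i) t / z i t)
    rw [mul_div_cancel₀ _ ht.ne']

/-! ### Adjoining an antiderivative to a Hardy field. -/

theorem exists_eq_const_of_der_eq_zero {g : RGerm} (hg : g ∈ smoothGerms) (h : der g = 0) :
    ∃ c : ℝ, g = Germ.const c := by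
  induction g using Germ.inductionOn with | h f => ?_
  have hf := coe_mem_smoothGerms.1 hg
  have h : ∀ᶠ t in atTop, deriv f t = 0 := Germ.coe_eq.1 h
  obtain ⟨a, ha⟩ := exists_monotoneOn_of_deriv_nonneg hf.differentiableAt (h.mono fun _ h => h.ge)
  obtain ⟨b, hb⟩ := exists_monotoneOn_of_deriv_nonneg (f := -f) hf.neg.differentiableAt
    (h.mono fun t h => by rw [deriv.neg, h, neg_zero])
  refine ⟨f (max a b), Germ.coe_eq.2 ?_⟩
  filter_upwards [eventually_ge_atTop (max a b)] with t ht
  have h₁ := ha (le_max_left a b) ((le_max_left a b).trans ht) ht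
  have h₂ := hb (le_max_right a b) ((le_max_right a b).trans ht) ht
  simp only [Pi.neg_apply] at h₂
  linarith

/-- If `g'` vanishes nowhere near infinity, Rolle's theorem leaves `g` at most one zero there. -/
theorem eq_zero_or_isUnit_of_der {g : RGerm} (hg : g ∈ smoothGerms)
    (h : der g = 0 ∨ IsUnit (der g)) : g = 0 ∨ IsUnit g := by
  rcases h with h | h
  · obtain ⟨c, rfl⟩ := exists_eq_const_of_der_eq_zero hg h
    by_cases h0 : c = 0
    · exact Or.inl (by rw [h0]; rfl)
    · exact Or.inr (isUnit_coe.2 (.of_forall fun _ => h0))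
  · induction g using Germ.inductionOn with | h f => ?_
    have hf := coe_mem_smoothGerms.1 hg
    refine Or.inr (isUnit_coe.2 ?_)
    obtain ⟨a, ha⟩ := eventually_atTop.1 ((isUnit_coe.1 h).and hf.continuousAt)
    by_cases hz : ∃ p ≥ a, f p = 0
    · obtain ⟨p, hpa, hp⟩ := hz
      filter_upwards [eventually_gt_atTop p] with t ht h0
      obtain ⟨c, hc, hc0⟩ := exists_deriv_eq_zero ht
        (fun s hs => (ha s (hpa.trans hs.1)).2.continuousWithinAt) (hp.trans h0.symm)
      exact (ha c (hpa.trans hc.1.le)).1 hc0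
    · filter_upwards [eventually_ge_atTop a] with t ht h0 using hz ⟨t, ht, h0⟩

theorem der_pow_succ {w : RGerm} (hw : w ∈ smoothGerms) (n : ℕ) :
    der (w ^ (n + 1)) = (n + 1 : ℕ) * w ^ n * der w := by
  induction n with
  | zero => simp
  | succ n ih =>
    rw [pow_succ w (n + 1), der_mul (smoothSubring.pow_mem hw _) hw, ih]
    push_cast
    ring

theorem der_sum_mul_pow {w : RGerm} (hw : w ∈ smoothGerms) {b : ℕ → RGerm}
    (hb : ∀ i, b i ∈ smoothGerms) (n : ℕ) :
    der (∑ i ∈ Finset.range (n + 1), b i * w ^ i) =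
      ∑ i ∈ Finset.range n, (der (b i) + (i + 1 : ℕ) * b (i + 1) * der w) * w ^ i +
        der (b n) * w ^ n := by
  induction n with
  | zero => simp
  | succ n ih =>
    rw [Finset.sum_range_succ, der_add
      (smoothSubring.sum_mem fun i _ => smoothSubring.mul_mem (hb i) (smoothSubring.pow_mem hw _))
      (smoothSubring.mul_mem (hb _) (smoothSubring.pow_mem hw _)), ih,
      der_mul (hb _) (smoothSubring.pow_mem hw _), der_pow_succ hw, Finset.sum_range_succ]
    ring

/-- Induction on the degree: make the polynomial monic, so that differentiating kills the top term.
Since `w'` is in `F`, the derivative is a polynomial in `w` over `F` of smaller degree, and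
`eq_zero_or_isUnit_of_der` lifts the dichotomy back. -/
theorem sum_mul_pow_eq_zero_or_isUnit {F : Subring RGerm} (hF : IsHardyField F) {w : RGerm}
    (hw : w ∈ smoothGerms) (hd : der w ∈ F) (n : ℕ) : ∀ a : ℕ → RGerm, (∀ i, a i ∈ F) →
    ∑ i ∈ Finset.range n, a i * w ^ i = 0 ∨ IsUnit (∑ i ∈ Finset.range n, a i * w ^ i) := by
  induction n with
  | zero => simp
  | succ n ih =>
    intro a ha
    by_cases h0 : a n = 0
    · rw [Finset.sum_range_succ, h0, zero_mul, add_zero]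
      exact ih a ha
    obtain ⟨c, hc, hac⟩ := hF.isUnit (ha n) h0
    have hb : ∀ i, a i * c ∈ F := fun i => F.mul_mem (ha i) hc
    have hs : ∑ i ∈ Finset.range (n + 1), a i * w ^ i =
        a n * ∑ i ∈ Finset.range (n + 1), (a i * c) * w ^ i := by
      rw [Finset.mul_sum]
      refine Finset.sum_congr rfl fun i _ => ?_
      calc a i * w ^ i = a i * w ^ i * (a n * c) := by rw [hac, mul_one]
        _ = _ := by ring
    have key := eq_zero_or_isUnit_of_der
      (g := ∑ i ∈ Finset.range (n + 1), (a i * c) * w ^ i)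
      (smoothSubring.sum_mem fun i _ => smoothSubring.mul_mem (hF.subset_smooth _ (hb i))
        (smoothSubring.pow_mem hw _)) (by
        rw [der_sum_mul_pow hw fun i => hF.subset_smooth _ (hb i), hac, der_one, zero_mul, add_zero]
        exact ih _ fun i => F.add_mem (hF.der_mem _ (hb i))
          (F.mul_mem (F.mul_mem (natCast_mem F _) (hb _)) hd))
    rw [hs]
    rcases key with h | h
    · exact Or.inl (by rw [h, mul_zero])
    · exact Or.inr ((IsUnit.of_mul_eq_one _ hac).mul h)

theorem IsHardyField.isHardianOver_of_der_mem {F : Subring RGerm} (hF : IsHardyField F) {w : RGerm}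
    (hw : w ∈ smoothGerms) (hd : der w ∈ F) : IsHardianOver F w := by
  have hFle : (F : Set RGerm) ⊆ Subring.closure ((F : Set RGerm) ∪ {w}) :=
    Set.subset_union_left.trans Subring.subset_closure
  obtain ⟨K, hK, hS⟩ := exists_isHardyField_of_generators (S := (F : Set RGerm) ∪ {w})
    (by
      rintro a (ha | rfl)
      exacts [hF.subset_smooth a ha, hw])
    (by
      rintro a (ha | rfl)
      exacts [hFle (hF.der_mem a ha), hFle hd])
    (by
      intro a ha h0
      have hle : Subring.closure ((F : Set RGerm) ∪ {w}) ≤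
          (Polynomial.aeval (R := F) w).toRingHom.range := by
        refine Subring.closure_le.2 ?_
        rintro a (ha | rfl)
        · exact ⟨Polynomial.C ⟨a, ha⟩, Polynomial.aeval_C _ _⟩
        · exact ⟨Polynomial.X, Polynomial.aeval_X _⟩
      obtain ⟨p, rfl⟩ := hle ha
      have hp : Polynomial.aeval w p =
          ∑ i ∈ Finset.range (p.natDegree + 1), (p.coeff i : RGerm) * w ^ i :=
        Polynomial.aeval_eq_sum_range w
      change Polynomial.aeval w p ≠ 0 at h0
      change IsUnit (Polynomial.aeval w p)
      rw [hp] at h0 ⊢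
      exact (sum_mul_pow_eq_zero_or_isUnit hF hw hd _ _ fun i => (p.coeff i).2).resolve_left h0)
  exact ⟨K, hK, Set.subset_union_left.trans hS, hS (Or.inr rfl)⟩

/-! ### Lexicographic dominance and adjoining a whole chain. -/

/-- At the first differing index `i`, the extra factor `x i` outweighs `c` and all later factors of
the smaller monomial, which together are at most a power of `x (i + 1)`; the `+ 1` in that exponent
absorbs `c`. -/
theorem mul_prod_pow_lt_prod_pow {x : ℕ → ℝ} {α β : ℕ → ℕ} {i N : ℕ} {c : ℝ} (hiN : i < N)
    (hαβ : ∀ j < i, α j = β j) (hi : α i < β i) (h1 : ∀ j ≤ N, 1 ≤ x j)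
    (hx : ∀ j < N, i + 1 ≤ j → x j ≤ x (i + 1)) (hc0 : 0 ≤ c) (hc : c < x (i + 1))
    (hpow : x (i + 1) ^ (∑ j ∈ Finset.Ico (i + 1) N, α j + 1) < x i) :
    c * ∏ j ∈ Finset.range N, x j ^ α j < ∏ j ∈ Finset.range N, x j ^ β j := by
  rw [← Finset.prod_range_mul_prod_Ico (fun j => x j ^ α j) hiN,
    ← Finset.prod_range_mul_prod_Ico (fun j => x j ^ β j) hiN, Finset.prod_range_succ,
    Finset.prod_range_succ, Finset.prod_congr (rfl : Finset.range i = Finset.range i)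
      (fun j hj => by rw [hαβ j (Finset.mem_range.1 hj)])]
  have hA : 0 < ∏ j ∈ Finset.range i, x j ^ β j := Finset.prod_pos fun j hj =>
    pow_pos (one_pos.trans_le (h1 j ((Finset.mem_range.1 hj).le.trans hiN.le))) _
  have hT : ∏ j ∈ Finset.Ico (i + 1) N, x j ^ α j ≤
      x (i + 1) ^ ∑ j ∈ Finset.Ico (i + 1) N, α j := by
    rw [← Finset.prod_pow_eq_pow_sum]
    refine Finset.prod_le_prod (fun j hj => ?_) fun j hj => ?_
    · exact pow_nonneg (zero_le_one.trans (h1 j (Finset.mem_Ico.1 hj).2.le)) _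
    · exact pow_le_pow_left₀ (zero_le_one.trans (h1 j (Finset.mem_Ico.1 hj).2.le))
        (hx j (Finset.mem_Ico.1 hj).2 (Finset.mem_Ico.1 hj).1) _
  have hT0 : 0 ≤ ∏ j ∈ Finset.Ico (i + 1) N, x j ^ α j := Finset.prod_nonneg fun j hj =>
    pow_nonneg (zero_le_one.trans (h1 j (Finset.mem_Ico.1 hj).2.le)) _
  have hT1 : 1 ≤ ∏ j ∈ Finset.Ico (i + 1) N, x j ^ β j := by
    rw [← Finset.prod_const_one (s := Finset.Ico (i + 1) N)]
    exact Finset.prod_le_prod (fun _ _ => zero_le_one)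
      fun j hj => one_le_pow₀ (h1 j (Finset.mem_Ico.1 hj).2.le)
  have hxi : 1 ≤ x i := h1 i hiN.le
  have hcT : c * ∏ j ∈ Finset.Ico (i + 1) N, x j ^ α j < x i := by
    refine lt_of_le_of_lt ?_ hpow
    rw [pow_succ']
    exact mul_le_mul hc.le hT hT0 (hc0.trans hc.le)
  calc _ = (∏ j ∈ Finset.range i, x j ^ β j) * (x i ^ α i *
        (c * ∏ j ∈ Finset.Ico (i + 1) N, x j ^ α j)) := by ring
    _ < (∏ j ∈ Finset.range i, x j ^ β j) * (x i ^ α i * x i) := by gcongr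
    _ = (∏ j ∈ Finset.range i, x j ^ β j) * x i ^ (α i + 1) * 1 := by rw [pow_succ, mul_one]
    _ ≤ _ := by gcongr; exact hi

theorem LogDerChain.mul_prod_lt_prod {z : ℕ → ℝ → ℝ} (hz : LogDerChain z) {h : ℝ → ℝ}
    (hh : ∀ i, ∀ᶠ t in atTop, |h t| < z i t) {α β : ℕ →₀ ℕ} (hαβ : toLex α < toLex β) :
    ∀ᶠ t in atTop, |h t| * ∏ j ∈ α.support, z j t ^ α j < ∏ j ∈ β.support, z j t ^ β j := by
  obtain ⟨i, hj, hi⟩ := Finsupp.lex_def.1 hαβ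
  obtain ⟨N, hN⟩ := (α.support ∪ β.support).exists_nat_subset_range
  have hiN : i < N := Finset.mem_range.1 (hN (Finset.mem_union_right _
    (Finsupp.mem_support_iff.2 (Nat.ne_zero_of_lt hi))))
  have hle : ∀ j, i + 1 ≤ j → ∀ᶠ t in atTop, z j t ≤ z (i + 1) t := by
    intro j hj
    induction j, hj using Nat.le_induction with
    | base => exact .of_forall fun _ => le_rfl
    | succ j _ ih => filter_upwards [ih, hz.lt j] with t h₁ h₂ using h₂.le.trans h₁
  have e1 : ∀ᶠ t in atTop, ∀ j ∈ Finset.range (N + 1), 1 ≤ z j t :=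
    (Finset.eventually_all _).2 fun j _ => (hz.tendsto_atTop j).eventually_ge_atTop 1
  have e2 : ∀ᶠ t in atTop, ∀ j ∈ Finset.range N, i + 1 ≤ j → z j t ≤ z (i + 1) t :=
    (Finset.eventually_all _).2 fun j _ => by
      by_cases hij : i + 1 ≤ j
      · filter_upwards [hle j hij] with t ht _ using ht
      · exact .of_forall fun _ h => absurd h hij
  filter_upwards [e1, e2, hh (i + 1),
    hz.pow_lt i (∑ j ∈ Finset.Ico (i + 1) N, α j + 1)] with t h₁ h₂ h₃ h₄
  rw [Finset.prod_subset (Finset.subset_union_left.trans hN) (f := fun j => z j t ^ α j)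
      (fun j _ h => by rw [Finsupp.notMem_support_iff.1 h, pow_zero]),
    Finset.prod_subset (Finset.subset_union_right.trans hN) (f := fun j => z j t ^ β j)
      (fun j _ h => by rw [Finsupp.notMem_support_iff.1 h, pow_zero])]
  exact mul_prod_pow_lt_prod_pow (x := fun j => z j t) hiN hj hi
    (fun j hj => h₁ j (Finset.mem_range.2 (Nat.lt_succ_of_le hj)))
    (fun j hj => h₂ j (Finset.mem_range.2 hj)) (abs_nonneg _) h₃ h₄

theorem LogDerChain.isUnit_aeval {z : ℕ → ℝ → ℝ} (hz : LogDerChain z) {H : Subring RGerm}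
    (hH : IsHardyField H) (hzH : ∀ i, ∀ h ∈ H, LtE h (z i : RGerm)) {P : MvPolynomial ℕ H}
    (hP : P ≠ 0) : IsUnit (MvPolynomial.aeval (fun i => (z i : RGerm)) P) := by
  have habs : ∀ h : ℝ → ℝ, (h : RGerm) ∈ H → ∀ i, ∀ᶠ t in atTop, |h t| < z i t := by
    intro h hh i
    filter_upwards [ltE_coe.1 (hzH i _ hh), ltE_coe.1 (hzH i _ (H.neg_mem hh))] with t h₁ h₂
    exact abs_lt.2 ⟨neg_lt.1 h₂, h₁⟩
  have hrep : ∀ α, ∃ c : ℝ → ℝ, (c : RGerm) = (P.coeff α : H) := fun α => by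
    generalize ((P.coeff α : H) : RGerm) = g
    induction g using Germ.inductionOn with | h c => exact ⟨c, rfl⟩
  choose c hc using hrep
  have hsum : MvPolynomial.aeval (fun i => (z i : RGerm)) P =
      ((∑ α ∈ P.support, c α * ∏ i ∈ α.support, z i ^ α i : ℝ → ℝ) : RGerm) := by
    rw [MvPolynomial.aeval_def, MvPolynomial.eval₂_eq]
    change _ = Germ.coeRingHom atTop _
    rw [map_sum]
    refine Finset.sum_congr rfl fun α _ => ?_
    rw [map_mul, map_prod]
    congr 1
    · exact (hc α).symm
  obtain ⟨α₀, hα₀, hmax⟩ := Finset.exists_max_image P.support (fun α => toLex α)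
    (MvPolynomial.support_nonempty.2 hP)
  obtain ⟨d, hd, hcd⟩ := hH.isUnit (P.coeff α₀).2
    (fun h => MvPolynomial.mem_support_iff.1 hα₀ (Subtype.ext h))
  induction d using Germ.inductionOn with | h d => ?_
  rw [← hc] at hcd
  have hcd : ∀ᶠ t in atTop, c α₀ t * d t = 1 := Germ.coe_eq.1 hcd
  -- After division by the leading coefficient, the factor `P.support.card` makes each other term
  -- smaller than the leading monomial divided by the number of terms. At a zero of the sum this
  -- would give `card * m ≤ (card - 1) * m` with `m > 0`.
  have hdom : ∀ᶠ t in atTop, ∀ α ∈ P.support.erase α₀,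
      |((P.support.card : ℕ) : ℝ) * (c α t * d t)| * ∏ j ∈ α.support, z j t ^ α j <
        ∏ j ∈ α₀.support, z j t ^ α₀ j := by
    refine (Finset.eventually_all _).2 fun α hα => ?_
    refine hz.mul_prod_lt_prod (h := fun t => ((P.support.card : ℕ) : ℝ) * (c α t * d t))
      (habs _ ?_) (lt_of_le_of_ne (hmax α (Finset.mem_of_mem_erase hα))
        fun h => Finset.ne_of_mem_erase hα (toLex.injective h))
    have : ((P.support.card : ℕ) : RGerm) * (((P.coeff α : H) : RGerm) * (d : RGerm)) ∈ H :=
      H.mul_mem (natCast_mem H _) (H.mul_mem (P.coeff α).2 hd)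
    rw [← hc] at this
    exact this
  rw [hsum, isUnit_coe]
  filter_upwards [hdom, hcd, (Finset.eventually_all P.support).2 fun α _ =>
    (Finset.eventually_all α.support).2 fun i _ => hz.pos i] with t h₁ h₂ h₃ h0
  have hm : 0 < ∏ j ∈ α₀.support, z j t ^ α₀ j :=
    Finset.prod_pos fun j hj => pow_pos (h₃ α₀ hα₀ j hj) _
  simp only [Finset.sum_apply, Pi.mul_apply, Finset.prod_apply, Pi.pow_apply] at h0
  rw [← Finset.add_sum_erase _ _ hα₀] at h0
  have e : ∏ j ∈ α₀.support, z j t ^ α₀ j =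
      ∑ α ∈ P.support.erase α₀, -(c α t * d t) * ∏ j ∈ α.support, z j t ^ α j := by
    calc _ = c α₀ t * d t * ∏ j ∈ α₀.support, z j t ^ α₀ j := by rw [h₂, one_mul]
      _ = d t * (c α₀ t * ∏ j ∈ α₀.support, z j t ^ α₀ j) := by ring
      _ = d t * -∑ α ∈ P.support.erase α₀, c α t * ∏ j ∈ α.support, z j t ^ α j := by
        rw [eq_neg_of_add_eq_zero_left h0]
      _ = _ := by
        rw [mul_neg, Finset.mul_sum, ← Finset.sum_neg_distrib]
        exact Finset.sum_congr rfl fun _ _ => by ring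
  have hle : P.support.card * ∏ j ∈ α₀.support, z j t ^ α₀ j ≤
      ∑ α ∈ P.support.erase α₀, ∏ j ∈ α₀.support, z j t ^ α₀ j := by
    conv_lhs => rw [e]
    rw [Finset.mul_sum]
    refine Finset.sum_le_sum fun α hα => le_trans ?_ (h₁ α hα).le
    rw [← mul_assoc]
    refine mul_le_mul_of_nonneg_right ?_ (Finset.prod_nonneg fun j hj => ?_)
    · rw [mul_neg]
      exact neg_le_abs _
    · exact pow_nonneg (h₃ α (Finset.mem_of_mem_erase hα) j hj).le _
  rw [Finset.sum_const, nsmul_eq_mul] at hle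
  have := le_of_mul_le_mul_right hle hm
  exact (Nat.cast_le.1 this).not_gt (Finset.card_erase_lt_of_mem hα₀)

theorem LogDerChain.isHardianOver {z : ℕ → ℝ → ℝ} (hz : LogDerChain z) {H : Subring RGerm}
    (hH : IsHardyField H) (hzH : ∀ i, ∀ h ∈ H, LtE h (z i : RGerm)) :
    IsHardianOver H (z 0 : RGerm) := by
  set S : Set RGerm := (H : Set RGerm) ∪ Set.range fun i => (z i : RGerm) with hS
  have hzS : ∀ i, (z i : RGerm) ∈ Subring.closure S := fun i =>
    Subring.subset_closure (Or.inr ⟨i, rfl⟩)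
  obtain ⟨K, hK, hSK⟩ := exists_isHardyField_of_generators (S := S)
    (by
      rintro _ (ha | ⟨i, rfl⟩)
      exacts [hH.subset_smooth _ ha, coe_mem_smoothGerms.2 (hz.smooth i)])
    (by
      rintro _ (ha | ⟨i, rfl⟩)
      · exact Subring.subset_closure (Or.inl (hH.der_mem _ ha))
      · have : der (z i : RGerm) = (z i : RGerm) * (z (i + 1) : RGerm) :=
          Germ.coe_eq.2 (hz.deriv_eq i)
        rw [this]
        exact Subring.mul_mem _ (hzS i) (hzS (i + 1)))
    (by
      intro a ha h0
      have hle : Subring.closure S ≤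
          (MvPolynomial.aeval (R := H) fun i => (z i : RGerm)).toRingHom.range := by
        refine Subring.closure_le.2 ?_
        rintro _ (ha | ⟨i, rfl⟩)
        · exact ⟨MvPolynomial.C ⟨_, ha⟩, MvPolynomial.aeval_C _ _⟩
        · exact ⟨MvPolynomial.X i, MvPolynomial.aeval_X _ _⟩
      obtain ⟨P, rfl⟩ := hle ha
      exact hz.isUnit_aeval hH hzH (fun h => h0 (by rw [h, map_zero])))
  exact ⟨K, hK, fun a ha => hSK (Or.inl ha), hSK (Or.inr ⟨0, rfl⟩)⟩

/-! ### Chains above a Liouville closed Hardy field. -/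

/-- For `t ≥ 0`, `(t * g)' = g + t * g' ≥ g = f'`. Applied to a logarithm `f`, it bounds the
logarithmic derivative from below. -/
theorem exists_le_add_mul_of_deriv_nonneg {f g : ℝ → ℝ}
    (hf : ∀ᶠ t in atTop, HasDerivAt f (g t) t) (hg : ∀ᶠ t in atTop, DifferentiableAt ℝ g t)
    (h : ∀ᶠ t in atTop, 0 ≤ deriv g t) : ∃ C, ∀ᶠ t in atTop, f t ≤ t * g t + C := by
  have hd : ∀ᶠ t in atTop, HasDerivAt (fun s => s * g s) (1 * g t + t * deriv g t) t := by
    filter_upwards [hg] with t ht using (hasDerivAt_id' t).mul ht.hasDerivAt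
  refine exists_le_add_of_deriv_le (f := fun s => s * g s) (hd.mono fun _ h => h.differentiableAt)
    (hf.mono fun _ h => h.differentiableAt) ?_
  filter_upwards [hd, hf, h, eventually_ge_atTop 0] with t h₁ h₂ h₃ h₄
  rw [h₁.deriv, h₂.deriv]
  nlinarith [mul_nonneg h₄ h₃]

theorem LogDerChain.exists_log_le {z : ℕ → ℝ → ℝ} (hz : LogDerChain z) :
    ∃ C, ∀ᶠ t in atTop, Real.log (z 0 t) ≤ t * z 1 t + C := by
  refine exists_le_add_mul_of_deriv_nonneg (hz.hasDerivAt_log 0) (hz.differentiableAt 1) ?_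
  filter_upwards [hz.deriv_eq 1, hz.pos 1, hz.pos 2] with t h₁ h₂ h₃
  rw [h₁]
  exact (mul_pos h₂ h₃).le

theorem ltE_expIter {n : ℕ} {f : ℝ → ℝ} :
    LtE (expIter n) (f : RGerm) ↔ ∀ᶠ t in atTop, Real.exp^[n] t < f t := Iff.rfl

namespace IsLiouvilleClosedHardyField

variable {H : Subring RGerm}

theorem id_mem (hH : IsLiouvilleClosedHardyField H) (hR : ContainsReals H) :
    ((id : ℝ → ℝ) : RGerm) ∈ H := by
  obtain ⟨g, hg, hd⟩ := hH.exists_integral 1 H.one_mem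
  have hid : ((id : ℝ → ℝ) : RGerm) ∈ smoothGerms :=
    coe_mem_smoothGerms.2 fun r => .of_forall fun _ => contDiffAt_id
  have hdid : der ((id : ℝ → ℝ) : RGerm) = 1 := by
    rw [der_coe, deriv_id']
    rfl
  have hgs := hH.isHardyField.subset_smooth g hg
  obtain ⟨c, hc⟩ := exists_eq_const_of_der_eq_zero
    (g := ((id : ℝ → ℝ) : RGerm) + -g) (smoothSubring.add_mem hid (smoothSubring.neg_mem hgs)) (by
      rw [der_add hid (smoothSubring.neg_mem hgs), der_neg, hd, hdid, add_neg_cancel])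
  rw [eq_add_of_add_neg_eq hc]
  exact H.add_mem (hR c) hg

/-- A nonzero `w` in `H` with `w' = f' * w` is a constant multiple of `exp f`, because `w * exp
(-f)` has derivative zero. -/
theorem exp_mem (hH : IsLiouvilleClosedHardyField H) (hR : ContainsReals H) {f : ℝ → ℝ}
    (hf : (f : RGerm) ∈ H) : (((fun t => Real.exp (f t)) : ℝ → ℝ) : RGerm) ∈ H := by
  obtain ⟨w, hw, hw0, hd⟩ := hH.exists_exp_integral _ (hH.isHardyField.der_mem _ hf)
  induction w using Germ.inductionOn with | h g => ?_
  have hfs := coe_mem_smoothGerms.1 (hH.isHardyField.subset_smooth _ hf)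
  have hgs := coe_mem_smoothGerms.1 (hH.isHardyField.subset_smooth _ hw)
  have hd : ∀ᶠ t in atTop, deriv g t = deriv f t * g t := Germ.coe_eq.1 hd
  obtain ⟨c, hc⟩ := exists_eq_const_of_der_eq_zero
    (g := (((fun t => g t * Real.exp (-f t)) : ℝ → ℝ) : RGerm))
    (coe_mem_smoothGerms.2 fun r => by
      filter_upwards [hfs r, hgs r] with t h₁ h₂ using h₂.mul h₁.neg.exp) (Germ.coe_eq.2 (by
      filter_upwards [hfs.differentiableAt, hgs.differentiableAt, hd] with t h₁ h₂ h₃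
      refine (h₂.hasDerivAt.mul h₁.hasDerivAt.neg.exp).deriv.trans ?_
      rw [h₃]
      simp only [Pi.neg_apply]
      ring))
  have hc : ∀ᶠ t in atTop, g t * Real.exp (-f t) = c := Germ.coe_eq.1 hc
  have hg : ∀ᶠ t in atTop, g t = c * Real.exp (f t) := by
    filter_upwards [hc] with t ht
    rw [← ht, mul_assoc, ← Real.exp_add, neg_add_cancel, Real.exp_zero, mul_one]
  have hc0 : c ≠ 0 := by
    rintro rfl
    refine hw0 (Germ.coe_eq.2 ?_)
    filter_upwards [hg] with t ht
    rw [ht, zero_mul]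
  have : (((fun t => Real.exp (f t)) : ℝ → ℝ) : RGerm) = Germ.const c⁻¹ * (g : RGerm) := by
    refine Germ.coe_eq.2 ?_
    filter_upwards [hg] with t ht
    rw [ht, inv_mul_cancel_left₀ hc0]
  rw [this]
  exact H.mul_mem (hR _) hw

theorem expIter_mem (hH : IsLiouvilleClosedHardyField H) (hR : ContainsReals H) (n : ℕ) :
    expIter n ∈ H := by
  induction n with
  | zero => exact hH.id_mem hR
  | succ n ih =>
    rw [expIter, Function.iterate_succ']
    exact hH.exp_mem hR ih

theorem ltE_logDerChain (hH : IsLiouvilleClosedHardyField H) (hR : ContainsReals H) (i : ℕ) :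
    ∀ {z : ℕ → ℝ → ℝ}, LogDerChain z → (∀ h ∈ H, LtE h (z 0 : RGerm)) →
      ∀ h ∈ H, LtE h (z i : RGerm) := by
  induction i with
  | zero => exact fun _ h => h
  | succ i ih =>
    intro z hz h0
    refine ih hz.tail fun h hh => ?_
    induction h using Germ.inductionOn with | h f => ?_
    obtain ⟨C, hC⟩ := hz.exists_log_le
    -- The germ `exp (t * f + C)` is in `H`, hence below `z 0`; comparing with `log (z 0) ≤ t * z 1
    -- + C` gives `f < z 1`.
    have hmem : (((fun t => t * f t + C) : ℝ → ℝ) : RGerm) ∈ H :=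
      H.add_mem (H.mul_mem (hH.id_mem hR) hh) (hR C)
    filter_upwards [hC, ltE_coe.1 (h0 _ (hH.exp_mem hR hmem)), hz.pos 0, eventually_gt_atTop 0]
      with t h₁ h₂ h₃ h₄
    have := (Real.lt_log_iff_exp_lt h₃).2 h₂
    exact lt_of_mul_lt_mul_left (by linarith : t * f t < t * z 1 t) h₄.le

end IsLiouvilleClosedHardyField

/-! ### The constants as a base field for arbitrary overhardian germs. -/

/-- The Hardy field of germs of constant functions. -/
noncomputable def constSubring : Subring RGerm :=
  ((Germ.coeRingHom atTop).comp (Pi.constRingHom ℝ ℝ)).range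

theorem isHardyField_constSubring : IsHardyField constSubring := by
  refine ⟨?_, ⟨⟨0, 1, zero_ne_one⟩, mul_comm, ?_⟩, ?_⟩
  · rintro _ ⟨c, rfl⟩
    exact coe_mem_smoothGerms.2 (SmoothAtTop.const c)
  · rintro ⟨_, c, rfl⟩ h0
    have hc : c ≠ 0 := by
      rintro rfl
      exact h0 rfl
    refine ⟨⟨_, c⁻¹, rfl⟩, Subtype.ext ?_⟩
    change (Germ.coeRingHom atTop).comp (Pi.constRingHom ℝ ℝ) c *
      (Germ.coeRingHom atTop).comp (Pi.constRingHom ℝ ℝ) c⁻¹ = 1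
    rw [← map_mul, mul_inv_cancel₀ hc, map_one]
  · rintro _ ⟨c, rfl⟩
    have : der ((Germ.coeRingHom atTop).comp (Pi.constRingHom ℝ ℝ) c) = 0 := der_const c
    rw [this]
    exact Subring.zero_mem _

theorem LogDerChain.isHardianOver_constSubring {z : ℕ → ℝ → ℝ} (hz : LogDerChain z) :
    IsHardianOver constSubring (z 0 : RGerm) := by
  refine hz.isHardianOver isHardyField_constSubring ?_
  rintro i _ ⟨c, rfl⟩
  exact (hz.tendsto_atTop i).eventually_gt_atTop c

/-! ### Transexponential elements of a Hardy field. -/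

theorem IsHardyField.trichotomy {F : Subring RGerm} (hF : IsHardyField F) {f : ℝ → ℝ}
    (hf : (f : RGerm) ∈ F) : (∀ᶠ t in atTop, f t = 0) ∨ (∀ᶠ t in atTop, 0 < f t) ∨
      ∀ᶠ t in atTop, f t < 0 := by
  by_cases h0 : (f : RGerm) = 0
  · exact Or.inl (Germ.coe_eq.1 h0)
  obtain ⟨b, -, hb⟩ := hF.isUnit hf h0
  have hs := coe_mem_smoothGerms.1 (hF.subset_smooth _ hf)
  obtain ⟨a, ha⟩ := eventually_atTop.1
    ((isUnit_coe.1 (IsUnit.of_mul_eq_one _ hb)).and hs.continuousAt)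
  have hc : ContinuousOn f (Set.Ici a) := fun t ht => (ha t ht).2.continuousWithinAt
  have hmem : ∀ s ≥ a, ∀ t ≥ a, f s < 0 → ¬ 0 < f t := fun s hs t ht h₁ h₂ => by
    obtain ⟨u, hu, hu0⟩ := isPreconnected_Ici.intermediate_value hs ht hc ⟨h₁.le, h₂.le⟩
    exact (ha u hu).1 hu0
  rcases lt_or_gt_of_ne (ha a le_rfl).1 with h | h
  · refine Or.inr (Or.inr ?_)
    filter_upwards [eventually_ge_atTop a] with t ht
    exact lt_of_le_of_ne (not_lt.1 (hmem a le_rfl t ht h)) (ha t ht).1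
  · refine Or.inr (Or.inl ?_)
    filter_upwards [eventually_ge_atTop a] with t ht
    exact lt_of_le_of_ne (not_lt.1 fun h' => hmem t ht a le_rfl h' h) (ha t ht).1.symm

theorem le_exp_iterate (n : ℕ) (t : ℝ) : t ≤ Real.exp^[n] t := by
  induction n with
  | zero => exact le_rfl
  | succ n ih =>
    rw [Function.iterate_succ_apply']
    linarith [Real.add_one_le_exp (Real.exp^[n] t)]

theorem IsHardyField.logDer_mem {F : Subring RGerm} (hF : IsHardyField F) {a : RGerm}
    (ha : a ∈ F) (h0 : a ≠ 0) : logDer a ∈ F := by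
  obtain ⟨b, hb, hab⟩ := hF.isUnit ha h0
  have : logDer a = der a * b := by
    rw [logDer]
    induction a using Germ.inductionOn with | h f => ?_
    induction b using Germ.inductionOn with | h g => ?_
    have hab : ∀ᶠ t in atTop, f t * g t = 1 := Germ.coe_eq.1 hab
    refine Germ.coe_eq.2 ?_
    filter_upwards [hab] with t ht
    rw [div_eq_mul_inv, inv_eq_of_mul_eq_one_right ht]
  rw [this]
  exact F.mul_mem (hF.der_mem a ha) hb

/-- The inductive step for overhardian germs. The logarithmic derivative `q` is unbounded, so `q' ≥
0` eventually and `log f ≤ t * q + C`; as `log f` exceeds every `exp_n(x)`, so does `q`. -/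
theorem IsHardyField.logDer_of_expIter_lt {F : Subring RGerm} (hF : IsHardyField F) {a : RGerm}
    (ha : a ∈ F) (h : ∀ n, LtE (expIter n) a) :
    LtE 0 a ∧ logDer a ∈ F ∧ (∀ n, LtE (expIter n) (logDer a)) ∧ LtE (logDer a) a := by
  induction a using Germ.inductionOn with | h f => ?_
  have hpos : ∀ᶠ t in atTop, 0 < f t := by
    filter_upwards [ltE_expIter.1 (h 0), eventually_ge_atTop 0] with t h₁ h₂ using h₂.trans_lt h₁
  have hq : logDer (f : RGerm) ∈ F := hF.logDer_mem ha fun h0 => by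
    obtain ⟨t, h₁, h₂⟩ := (hpos.and (Germ.coe_eq.1 h0)).exists
    exact h₁.ne' h₂
  obtain ⟨q, hqf⟩ : ∃ q : ℝ → ℝ, q = deriv f / f := ⟨_, rfl⟩
  have hqc : logDer (f : RGerm) = (q : RGerm) := by
    rw [hqf]
    rfl
  rw [hqc] at hq ⊢
  have hfs := coe_mem_smoothGerms.1 (hF.subset_smooth _ ha)
  have hqs := coe_mem_smoothGerms.1 (hF.subset_smooth _ hq)
  have hl : ∀ᶠ t in atTop, HasDerivAt (fun s => Real.log (f s)) (q t) t := by
    filter_upwards [hpos, hfs.differentiableAt] with t h₁ h₂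
    have := h₂.hasDerivAt.log h₁.ne'
    rw [hqf]
    exact this
  have hlog : ∀ n, ∀ᶠ t in atTop, Real.exp^[n] t < Real.log (f t) := fun n => by
    filter_upwards [ltE_expIter.1 (h (n + 1)), hpos] with t h₁ h₂
    rw [Function.iterate_succ_apply'] at h₁
    exact (Real.lt_log_iff_exp_lt h₂).2 h₁
  -- A bound on `q` would make `log f` grow at most linearly, while it exceeds `exp t`.
  have hunb : ∀ C, ¬ ∀ᶠ t in atTop, q t ≤ C := by
    intro C hC
    obtain ⟨D, hD⟩ := exists_le_add_of_deriv_le (f := fun t => C * t)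
      (.of_forall fun t => differentiableAt_id.const_mul C)
      (hl.mono fun _ h => h.differentiableAt) (by
        filter_upwards [hl, hC] with t h₁ h₂
        have : deriv (fun t : ℝ => C * t) t = C := by simp
        rwa [this, h₁.deriv])
    obtain ⟨t, h₁, h₂, h₃, h₄, h₅⟩ := (hD.and ((hlog 1).and ((eventually_ge_atTop 0).and
      ((eventually_ge_atTop (2 * C)).and (eventually_ge_atTop D))))).exists
    rw [Function.iterate_one] at h₂
    nlinarith [Real.quadratic_le_exp_of_nonneg h₃, mul_nonneg h₃ (sub_nonneg.2 h₄)]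
  have hdq : ∀ᶠ t in atTop, 0 ≤ deriv q t := by
    rcases hF.trichotomy (hF.der_mem _ hq) with h' | h' | h'
    · exact h'.mono fun _ h => h.ge
    · exact h'.mono fun _ h => h.le
    · obtain ⟨C, hC⟩ := exists_le_add_of_deriv_le (f := fun _ => (0 : ℝ))
        (.of_forall fun _ => differentiableAt_const _) hqs.differentiableAt (by
          filter_upwards [h'] with t ht
          rw [deriv_const]
          exact ht.le)
      exact absurd hC (hunb _)
  obtain ⟨C, hC⟩ := exists_le_add_mul_of_deriv_nonneg hl hqs.differentiableAt hdq
  refine ⟨hpos, hq, fun n => ?_, ?_⟩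
  -- With `u = exp_n t ≥ t ≥ 12`, `exp u ≥ u ^ 3 / 6 ≥ 2 * u ^ 2`, which leaves room for `t * u + C`
  -- when `C ≤ t`.
  · filter_upwards [hC, hlog (n + 1), eventually_ge_atTop 12, eventually_ge_atTop C]
      with t h₁ h₂ h₃ h₄
    have h₅ := le_exp_iterate n t
    rw [Function.iterate_succ_apply'] at h₂
    set u := Real.exp^[n] t
    have h₆ := Real.pow_div_factorial_le_exp u (by linarith) 3
    have h₇ : t * u < t * q t := by
      have : ((Nat.factorial 3 : ℕ) : ℝ) = 6 := by norm_num [Nat.factorial]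
      rw [this] at h₆
      have h₈ : 12 * u ^ 2 ≤ u ^ 3 := by nlinarith [sq_nonneg u]
      nlinarith
    exact lt_of_mul_lt_mul_left h₇ (by linarith)
  -- If `f ≤ q`, then `(-1/f)' = q / f ≥ 1` forces the negative function `-1/f` to tend to infinity.
  · have key : ¬ ∀ᶠ t in atTop, f t ≤ q t := by
      intro hle
      have hd : ∀ᶠ t in atTop, HasDerivAt (fun s => -(f s)⁻¹) (q t / f t) t := by
        filter_upwards [hpos, hfs.differentiableAt] with t h₁ h₂
        have := (h₂.hasDerivAt.inv h₁.ne').neg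
        refine this.congr_deriv ?_
        rw [hqf, Pi.div_apply]
        field_simp
      have ht := tendsto_atTop_of_le_deriv (hd.mono fun _ h => h.differentiableAt) one_pos (by
        filter_upwards [hd, hle, hpos] with t h₁ h₂ h₃
        rw [h₁.deriv]
        exact (one_le_div h₃).2 h₂)
      obtain ⟨t, h₁, h₂⟩ := ((ht.eventually_gt_atTop 0).and hpos).exists
      linarith [inv_pos.2 h₂]
    rcases hF.trichotomy (f := f - q) (F.sub_mem ha hq) with h' | h' | h'
    · exact absurd (h'.mono fun t ht => (sub_eq_zero.1 ht).le) key
    · exact h'.mono fun t ht => sub_pos.1 ht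
    · exact absurd (h'.mono fun t ht => (sub_neg.1 ht).le) key

theorem IsHardyField.isOverhardian {F : Subring RGerm} (hF : IsHardyField F) {y : RGerm}
    (hy : y ∈ F) (h : ∀ n, LtE (expIter n) y) : IsOverhardian y := by
  have key : ∀ i, iterLogDer y i ∈ F ∧ ∀ n, LtE (expIter n) (iterLogDer y i) := by
    intro i
    induction i with
    | zero => exact ⟨hy, h⟩
    | succ i ih =>
      have := hF.logDer_of_expIter_lt ih.1 ih.2
      exact ⟨this.2.1, this.2.2.1⟩
  refine ⟨hF.subset_smooth y hy, fun i => ?_⟩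
  have hi := hF.logDer_of_expIter_lt (key i).1 (key i).2
  refine ⟨?_, hi.1, hi.2.2.2⟩
  clear hi
  induction i with
  | zero => exact hF.subset_smooth y hy
  | succ i ih =>
    have hi := hF.logDer_of_expIter_lt (key i).1 (key i).2
    refine ⟨ih, hF.subset_smooth _ (key i).1, ?_⟩
    obtain ⟨b, hb, hab⟩ := hF.isUnit (key i).1 fun h0 => by
      have := hi.1
      rw [h0] at this
      obtain ⟨t, ht⟩ := Eventually.exists (f := atTop) this
      exact lt_irrefl _ ht
    exact ⟨b, hF.subset_smooth b hb, hab⟩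

/-! ### Transfer to germs, and the logarithm. -/

theorem IsHardian.isOverhardian {y : RGerm} (hy : IsHardian y) (h : ∀ n, LtE (expIter n) y) :
    IsOverhardian y := by
  obtain ⟨-, F, ⟨hF, hyF⟩, -⟩ := hy
  exact hF.isOverhardian hyF h

theorem IsOverhardian.isHardianOver_constSubring {y : RGerm} (hy : IsOverhardian y) :
    IsHardianOver constSubring y := by
  induction y using Germ.inductionOn with | h f => ?_
  obtain ⟨z, hz, rfl⟩ := hy.exists_logDerChain
  exact hz.isHardianOver_constSubring

theorem IsOverhardian.expIter_lt {y : RGerm} (hy : IsOverhardian y) (n : ℕ) :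
    LtE (expIter n) y := by
  induction y using Germ.inductionOn with | h f => ?_
  obtain ⟨z, hz, rfl⟩ := hy.exists_logDerChain
  exact LogDerChain.exp_iterate_lt n hz

theorem IsOverhardian.isHardianOver {H : Subring RGerm} (hH : IsLiouvilleClosedHardyField H)
    (hR : ContainsReals H) {y : RGerm} (hy : IsOverhardian y) (h : ∀ h ∈ H, LtE h y) :
    IsHardianOver H y := by
  induction y using Germ.inductionOn with | h f => ?_
  obtain ⟨z, hz, rfl⟩ := hy.exists_logDerChain
  exact hz.isHardianOver hH.isHardyField fun i => hH.ltE_logDerChain hR i hz h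

/-- Since `(log y)' = y'/y` lies in a Hardy field containing `y`, `log y` can be adjoined; it
exceeds `exp_n(x)` because `y` exceeds `exp_{n+1}(x)`. -/
theorem IsOverhardian.logGerm {y : RGerm} (hy : IsOverhardian y) : IsOverhardian (logGerm y) := by
  obtain ⟨F, hF, -, hyF⟩ := hy.isHardianOver_constSubring
  have hexp := hy.expIter_lt
  obtain ⟨h0, hd, -⟩ := hF.logDer_of_expIter_lt hyF hexp
  induction y using Germ.inductionOn with | h f => ?_
  have hpos : ∀ᶠ t in atTop, 0 < f t := h0
  have hfs := coe_mem_smoothGerms.1 hy.1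
  have hder : der (HardyGerm.logGerm (f : RGerm)) = logDer (f : RGerm) := by
    refine Germ.coe_eq.2 ?_
    filter_upwards [hpos, hfs.differentiableAt] with t h₁ h₂
    exact (h₂.hasDerivAt.log h₁.ne').deriv
  obtain ⟨K, hK, -, hw⟩ := hF.isHardianOver_of_der_mem (w := HardyGerm.logGerm (f : RGerm))
    (coe_mem_smoothGerms.2 (hfs.log (hpos.mono fun _ h => h.ne'))) (by rwa [hder])
  refine hK.isOverhardian hw fun n => ?_
  have h₁ := hexp (n + 1)
  change ∀ᶠ t in atTop, Real.exp^[n] t < Real.log (f t)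
  filter_upwards [ltE_expIter.1 h₁, hpos] with t h₁ h₂
  rw [Function.iterate_succ_apply'] at h₁
  exact (Real.lt_log_iff_exp_lt h₂).2 h₁

end HardyGerm

theorem mainTheorem9 :
    (∀ H : Subring HardyGerm.RGerm, HardyGerm.IsLiouvilleClosedHardyField H →
      HardyGerm.ContainsReals H →
      ∀ y ∈ HardyGerm.contGerms, (∀ h ∈ H, HardyGerm.LtE h y) →
        List.TFAE [HardyGerm.IsOverhardian y, HardyGerm.IsHardianOver H y,
          HardyGerm.IsHardian y]) ∧
    (∀ y : HardyGerm.RGerm, HardyGerm.IsOverhardian y →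
      HardyGerm.IsOverhardian (HardyGerm.logGerm y)) ∧
    (∀ y ∈ HardyGerm.contGerms,
      (HardyGerm.IsOverhardian y ↔
        HardyGerm.IsHardian y ∧ ∀ n : ℕ, HardyGerm.LtE (HardyGerm.expIter n) y)) := by
  refine ⟨fun H hH hR y _ hy => ?_, fun y hy => hy.logGerm, fun y _ => ⟨fun h => ?_, fun h => ?_⟩⟩
  · tfae_have 1 → 2 := fun h => h.isHardianOver hH hR hy
    tfae_have 2 → 3 := fun h => h.isHardian
    tfae_have 3 → 1 := fun h => h.isOverhardian fun n => hy _ (hH.expIter_mem hR n)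
    tfae_finish
  · exact ⟨h.isHardianOver_constSubring.isHardian, h.expIter_lt⟩
  · exact h.1.isOverhardian h.2
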